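/- \textbf{Setting.} Fix $d_v\in\mathbb{N}$ and let $\mathcal C=(\mathcal C_t)_{t\ge 1}$ be a sequence of binary linear codes, $\mathcal C_t$ given by a parity check matrix $H=H_t\in\mathbb F_2^{m\times n}$ ($m=m_t$, $n=n_t\to\infty$) each of whose columns has exactly $d_v$ ones. The factor graph has variable nodes $1,\dots,n$, check nodes $1,\dots,m$, and an edge $ij$ iff $H_{ji}=1$; $N(\cdot)$ denotes neighbourhoods. Put $\mathcal P=\bigcap_j \mathrm{conv}\{x\in\{0,1\}^n: h_j^Tx=0 \bmod 2\}$, with $h_j^T$ the $j$-th row of $H$. \textbf{Algorithm} (parameters $\ell\in\mathbb N$ and $\lambda_1<0<\lambda_2$). Given a received word $y\in\{0,1\}^n$: (1) let $x^{(p)}$ minimize $\|x-y\|_1$ over $\mathcal P$; if $x^{(p)}$ is integral, output it. (2) Otherwise let $L$ index the $\ell$ entries of $y-x^{(p)}$ that are largest in absolute value (all entries if $\ell>n$), and output a minimizer over $\mathcal P$ of $\lambda_1\|(x-y)_L\|_1+\lambda_2\|(x-y)_{L^c}\|_1$. The algorithm \emph{corrects} an error set $S$ if, for every codeword $c$, when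 $c$ is sent and exactly the bits in $S$ are flipped, the output is always $c$, whichever minimizers are used and however ties are broken. \textbf{Certificates.} For an error set $S$ put $\gamma_i=-1$ for $i\in S$ and $\gamma_i=1$ for $i\notin S$. Feasible dual variables for $S$ are reals $\tau_{ij}$ on the edges with $\tau_{ij}+\tau_{i'j}\ge0$ for every check node $j$ and distinct $i,i'\in N(j)$, and $\sum_{j\in N(i)}\tau_{ij}<\gamma_i$ for all $i$. Let $M$ be a set of edges no two of which share a check node, and let $x>0$. The labelling $\tau^{M,x}$ gives, at each check node matched by $M$ to some $i\in S$, the value $-x$ to the edge towards $i$ and $x$ to the other edges at that check node; all remaining edges get $0$. \begin{itemize} \item $S$ is \emph{strongly certified} if, for some $\delta\in\mathbb R$, $\lambda=2-2\delta+1/d_v$, $M$ and $x$, $M$ is a $(\delta,\lambda)$-matching of $S$ and $\tau^{M,x}$ is feasible for $S$. Here $M$ is a $(\delta,\lambda)$-matching of $S$ if every $i\in S$ lies on at least $\delta d_v$ edges of $M$, and every $i\notin S$ with $|N(i)\cap N(S)|\ge(1-\lambda)d_v$ lies on at least $\lambda d_v$ edges of $M$. \item $S$ is \emph{weakly certified}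 if, for some integers $p\ge0$ and $0\le q\le d_v$ with $2p-d_v>d_v-q$, some $M$ and some $x$, $M$ is a $(p,q)$-matching on $S$ and $\tau^{M,x}$ is feasible for $S$. Here $M$ is a $(p,q)$-matching on $S$ if all its edges end in $S$, every $i\in S$ lies on exactly $p$ edges of $M$, and every $i\notin S$ is adjacent to at least $\max\{q-d_v+|N(i)\cap N(S)|,0\}$ check nodes of $N(S)$ that are not covered by $M$. \end{itemize} Let $p^*_{sd}$ be the supremum of all $p\in[0,1]$ such that, for all large $t$, every $S\subseteq\{1,\dots,n\}$ of size $\lfloor pn\rfloor$ is strongly certified. Let $p^*_{wd}$ be the supremum of all $p\in[0,1]$ such that the fraction of the sets $S$ of size $\lfloor pn\rfloor$ that are weakly certified tends to $1$ as $t\to\infty$. (The supremum of the empty set is taken to be $0$.) \textbf{Theorem.} For every such $\mathcal C$ there are $\varepsilon_1,\varepsilon_2>0$ and $\lambda_1<0<\lambda_2$ such that: \begin{enumerate} \item for all large $t$, the algorithm with $\ell=\lfloor(1+\varepsilon_1)p^*_{sd}n\rfloor$ corrects every error set of size at most $(1+\varepsilon_1)p^*_{sd}n$; \item if $p^*_{sd}>0$,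 then the algorithm with $\ell=\lfloor(1+\varepsilon_2)p^*_{wd}n\rfloor$ corrects almost all error sets of size $(1+\varepsilon_2)p^*_{wd}n$: for all integers $0\le k_t\le(1+\varepsilon_2)p^*_{wd}n_t$, the fraction of the error sets of size $k_t$ (among the subsets of $\{1,\dots,n_t\}$ of that size) that it fails to correct tends to $0$ as $t\to\infty$ (the fraction counts as $0$ if there are no such sets). \end{enumerate} -/

import Mathlib

open Filter Topology

noncomputable section

namespace ReweightedLP

variable {m n : ℕ}

/-! ### Codes, the relaxed polytope, the bit flipping channel -/

/-- The codewords of the code with parity check matrix `H`. -/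
def IsCodeword (H : Matrix (Fin m) (Fin n) (ZMod 2)) (c : Fin n → ZMod 2) : Prop :=
  H.mulVec c = 0

/-- A binary word seen as a `0/1` vector in `ℝⁿ`. -/
def toReal (c : Fin n → ZMod 2) : Fin n → ℝ := fun i => ((c i).val : ℝ)

/-- The polytope `𝒫 = ⋂ⱼ conv(𝒞ⱼ)`, where `𝒞ⱼ` consists of the binary words that satisfy
the `j`-th parity check. -/
def polytope (H : Matrix (Fin m) (Fin n) (ZMod 2)) : Set (Fin n → ℝ) :=
  ⋂ j : Fin m, convexHull ℝ (toReal '' {c : Fin n → ZMod 2 | H j ⬝ᵥ c = 0})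

/-- The word received when `c` is sent and exactly the bits in `S` are flipped. -/
def received (c : Fin n → ZMod 2) (S : Finset (Fin n)) : Fin n → ZMod 2 :=
  fun i => if i ∈ S then c i + 1 else c i

/-- The minimizers of `f` over `A`. -/
def minimizers (A : Set (Fin n → ℝ)) (f : (Fin n → ℝ) → ℝ) : Set (Fin n → ℝ) :=
  {x | x ∈ A ∧ ∀ z ∈ A, f x ≤ f z}

/-- `‖x_L‖₁`. -/
def l1On (L : Finset (Fin n)) (x : Fin n → ℝ) : ℝ := ∑ i ∈ L, |x i|

/-! ### The two-step decoder -/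

/-- The solutions of the LP decoder for the received vector `y`:
minimize `‖x - y‖₁` over the polytope. -/
def lpSolutions (H : Matrix (Fin m) (Fin n) (ZMod 2)) (y : Fin n → ℝ) : Set (Fin n → ℝ) :=
  minimizers (polytope H) fun x => l1On Finset.univ (x - y)

/-- The solutions of the reweighted LP:
minimize `lam₁ ‖(x - y)_L‖₁ + lam₂ ‖(x - y)_{Lᶜ}‖₁` over the polytope. -/
def weightedSolutions (H : Matrix (Fin m) (Fin n) (ZMod 2)) (lam₁ lam₂ : ℝ)
    (L : Finset (Fin n)) (y : Fin n → ℝ) : Set (Fin n → ℝ) :=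
  minimizers (polytope H) fun x => lam₁ * l1On L (x - y) + lam₂ * l1On Lᶜ (x - y)

def IsIntegral (x : Fin n → ℝ) : Prop := ∀ i, x i = 0 ∨ x i = 1

/-- `L` indexes `ℓ` entries of `d` that are largest in absolute value
(all the entries if `ℓ` exceeds the length); ties may be broken in any way. -/
def IsLargestEntries (ℓ : ℕ) (d : Fin n → ℝ) (L : Finset (Fin n)) : Prop :=
  L.card = min ℓ n ∧ ∀ i ∈ L, ∀ j ∉ L, |d j| ≤ |d i|

/-- All possible outputs of the reweighted decoder on the received vector `y`: run the LP decoder;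
if its solution is integral, return it; otherwise let `L` index the `ℓ` entries in which the
solution deviates most from `y`, and return a solution of the reweighted LP. All choices of an
optimal solution and all ways of breaking ties are allowed. -/
def decoderOutputs (H : Matrix (Fin m) (Fin n) (ZMod 2)) (ℓ : ℕ) (lam₁ lam₂ : ℝ)
    (y : Fin n → ℝ) : Set (Fin n → ℝ) :=
  {z | ∃ xp ∈ lpSolutions H y,
    (IsIntegral xp ∧ z = xp) ∨
    (¬ IsIntegral xp ∧ ∃ L, IsLargestEntries ℓ (y - xp) L ∧
      z ∈ weightedSolutions H lam₁ lam₂ L y)}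

/-- The reweighted decoder corrects the error set `S`: whatever codeword was sent, the decoder
returns that codeword, and can return nothing else. -/
def Corrects (H : Matrix (Fin m) (Fin n) (ZMod 2)) (ℓ : ℕ) (lam₁ lam₂ : ℝ)
    (S : Finset (Fin n)) : Prop :=
  ∀ c, IsCodeword H c → decoderOutputs H ℓ lam₁ lam₂ (toReal (received c S)) = {toReal c}

/-! ### The factor graph and feasible dual variables -/

/-- The check nodes adjacent to the variable node `i` in the factor graph. -/
def checksOf (H : Matrix (Fin m) (Fin n) (ZMod 2)) (i : Fin n) : Finset (Fin m) :=
  Finset.univ.filter fun j => H j i ≠ 0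

/-- `N(S)`, the check nodes adjacent to some variable node in `S`. -/
def nbrs (H : Matrix (Fin m) (Fin n) (ZMod 2)) (S : Finset (Fin n)) : Finset (Fin m) :=
  S.biUnion (checksOf H)

/-- Every variable node has degree `dv`. -/
def VariableRegular (H : Matrix (Fin m) (Fin n) (ZMod 2)) (dv : ℕ) : Prop :=
  ∀ i, (checksOf H i).card = dv

/-- The likelihood vector of the error set `S`: `-1` on `S` and `1` off `S`. -/
def likelihood (S : Finset (Fin n)) : Fin n → ℝ := fun i => if i ∈ S then -1 else 1

/-- Feasible dual variables for the likelihood vector `γ`. The second inequality is strict: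
this is what makes the all-zero word the unique optimum. -/
structure DualFeasible (H : Matrix (Fin m) (Fin n) (ZMod 2)) (γ : Fin n → ℝ)
    (τ : Fin n → Fin m → ℝ) : Prop where
  check : ∀ j i i', H j i ≠ 0 → H j i' ≠ 0 → i ≠ i' → 0 ≤ τ i j + τ i' j
  variable_lt : ∀ i, ∑ j ∈ checksOf H i, τ i j < γ i

/-- A set of edges `(variable node, check node)` of the factor graph, no two of which share a
check node. -/
def IsCheckMatching (H : Matrix (Fin m) (Fin n) (ZMod 2)) (M : Finset (Fin n × Fin m)) : Prop :=
  (∀ e ∈ M, H e.2 e.1 ≠ 0) ∧ ∀ e ∈ M, ∀ e' ∈ M, e.2 = e'.2 → e = e'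

/-- The number of edges of `M` at the variable node `i`. -/
def matchDegree (M : Finset (Fin n × Fin m)) (i : Fin n) : ℕ := (M.filter fun e => e.1 = i).card

open Classical in
/-- The dual variables that a matching `M` puts on the edges: at a check node that is matched to
`i ∈ S`, the edge to `i` gets `-x` and the other edges get `x`; all other edges get `0`. -/
def matchingLabel (S : Finset (Fin n)) (M : Finset (Fin n × Fin m)) (x : ℝ) :
    Fin n → Fin m → ℝ :=
  fun i j => if i ∈ S ∧ (i, j) ∈ M then -x else if ∃ i' ∈ S, (i', j) ∈ M then x else 0

/-- A `(δ, lam)`-matching of `S`: every node of `S` has at least `δ dv` edges of `M`, and every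
node off `S` that has at least `(1 - lam) dv` neighbours in `N(S)` has at least `lam dv` edges
of `M`. -/
structure IsDeltaLambdaMatching (H : Matrix (Fin m) (Fin n) (ZMod 2)) (dv : ℕ)
    (S : Finset (Fin n)) (δ lam : ℝ) (M : Finset (Fin n × Fin m)) : Prop where
  matching : IsCheckMatching H M
  on_set : ∀ i ∈ S, δ * dv ≤ (matchDegree M i : ℝ)
  off_set : ∀ i ∉ S, (1 - lam) * dv ≤ ((checksOf H i ∩ nbrs H S).card : ℝ) →
    lam * dv ≤ (matchDegree M i : ℝ)

/-- A `(p, q)`-matching on `S`: every node of `S` is matched with `p` check nodes, all of them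
distinct, and every node `i` off `S` is connected with at least `max {q - dv + |N(i) ∩ N(S)|, 0}`
check nodes in `N(S)` that are not matched (the subtraction of natural numbers truncates). -/
structure IsPQMatching (H : Matrix (Fin m) (Fin n) (ZMod 2)) (dv : ℕ)
    (S : Finset (Fin n)) (p q : ℕ) (M : Finset (Fin n × Fin m)) : Prop where
  matching : IsCheckMatching H M
  inside : ∀ e ∈ M, e.1 ∈ S
  on_set : ∀ i ∈ S, matchDegree M i = p
  off_set : ∀ i ∉ S, (q + (checksOf H i ∩ nbrs H S).card) - dv ≤
    ((checksOf H i ∩ nbrs H S) \ M.image Prod.snd).card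

/-- `S` has feasible dual variables that come from a `(δ, 2 - 2δ + 1/dv)`-matching. -/
def StrongCertified (H : Matrix (Fin m) (Fin n) (ZMod 2)) (dv : ℕ) (S : Finset (Fin n)) : Prop :=
  ∃ (δ x : ℝ) (M : Finset (Fin n × Fin m)),
    0 < x ∧ IsDeltaLambdaMatching H dv S δ (2 - 2 * δ + 1 / dv) M ∧
    DualFeasible H (likelihood S) (matchingLabel S M x)

/-- `S` has feasible dual variables that come from a `(p, q)`-matching with
`2 p - dv > dv - q ≥ 0`. -/
def WeakCertified (H : Matrix (Fin m) (Fin n) (ZMod 2)) (dv : ℕ) (S : Finset (Fin n)) : Prop :=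
  ∃ (p q : ℕ) (x : ℝ) (M : Finset (Fin n × Fin m)),
    0 < x ∧ q ≤ dv ∧ 2 * dv < 2 * p + q ∧ IsPQMatching H dv S p q M ∧
    DualFeasible H (likelihood S) (matchingLabel S M x)

/-! ### Thresholds of a sequence of codes -/

open Classical in
/-- The fraction of the `k`-element subsets of `{1, …, n}` for which `Q` fails. -/
def failFraction (n k : ℕ) (Q : Finset (Fin n) → Prop) : ℝ :=
  (((Finset.univ.powersetCard k).filter fun S => ¬ Q S).card : ℝ) / (n.choose k : ℝ)

/-- The strong threshold `p*_sd` of a sequence of codes with variable degree `dv`: the largest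
fraction `p` such that every set of size `p N` is certified. -/
def strongThreshold (dv : ℕ) (M N : ℕ → ℕ)
    (H : ∀ t, Matrix (Fin (M t)) (Fin (N t)) (ZMod 2)) : ℝ :=
  sSup {p : ℝ | 0 ≤ p ∧ p ≤ 1 ∧ ∀ᶠ t in atTop, ∀ S : Finset (Fin (N t)),
    S.card = ⌊p * N t⌋₊ → StrongCertified (H t) dv S}

/-- The weak threshold `p*_wd` of a sequence of codes with variable degree `dv`: the largest
fraction `p` such that almost all sets of size `p N` are certified. -/
def weakThreshold (dv : ℕ) (M N : ℕ → ℕ)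
    (H : ∀ t, Matrix (Fin (M t)) (Fin (N t)) (ZMod 2)) : ℝ :=
  sSup {p : ℝ | 0 ≤ p ∧ p ≤ 1 ∧
    Tendsto (fun t => failFraction (N t) ⌊p * N t⌋₊ (WeakCertified (H t) dv)) atTop (𝓝 0)}

end ReweightedLP

end

noncomputable section

namespace ReweightedLP

variable {m n : ℕ}

/-! ### The fundamental cone and the robust null property -/

/-! Matching certificates carry hidden slack. Their labels are `x` times an integer in {-1, 0, 1},
so the sums at the variable nodes are `x` times integers. With `K = ⌈1/x⌉ - 1`, these integers are
at most `-(K+1)` on `S` and at most `K` off `S`, and `K ≤ dv`. Pairing the labels with the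
fundamental cone therefore gives a gap of `1 + 1/dv` between the mass off `S` and on `S`,
independent of `n` (`robust_of_dualFeasible`). This holds for both kinds of certificate.

The slack makes the first program stable: if `S` exceeds a robust `S'` by a few positions, every LP
solution is within O(`|S \ S'|`) of the codeword in the 1-norm (`sum_abs_sub_le`). Hence the `ℓ`
largest deviations find nearly all of `S`. With weights -1 and 1, reweighting on `L` acts like the
unweighted program with error set `L ∆ S` (`weightedSolutions_eq`). That set is small, so its
robustness follows from the strong threshold. This is why a positive strong threshold also allows
the weak one to be exceeded; double counting transfers the failure fraction between set sizes. -/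

/-- The fundamental cone of the factor graph. -/
structure InCone (H : Matrix (Fin m) (Fin n) (ZMod 2)) (w : Fin n → ℝ) : Prop where
  nonneg : ∀ i, 0 ≤ w i
  check : ∀ j i, H j i ≠ 0 → w i ≤ ∑ i' ∈ (Finset.univ.filter fun i' => H j i' ≠ 0).erase i, w i'

/-- On the fundamental cone, the mass outside `S` exceeds that on `S` by a factor `1 + 1 / dv`. -/
def Robust (H : Matrix (Fin m) (Fin n) (ZMod 2)) (dv : ℕ) (S : Finset (Fin n)) : Prop :=
  ∀ w, InCone H w → (dv + 1 : ℝ) * ∑ i ∈ S, w i ≤ dv * ∑ i ∈ Sᶜ, w i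

theorem Robust.mono {H : Matrix (Fin m) (Fin n) (ZMod 2)} {dv : ℕ} {S S' : Finset (Fin n)}
    (h : Robust H dv S') (hS : S ⊆ S') : Robust H dv S := by
  intro w hw
  have h1 : ∑ i ∈ S, w i ≤ ∑ i ∈ S', w i :=
    Finset.sum_le_sum_of_subset_of_nonneg hS fun i _ _ => hw.nonneg i
  have h2 : ∑ i ∈ S'ᶜ, w i ≤ ∑ i ∈ Sᶜ, w i :=
    Finset.sum_le_sum_of_subset_of_nonneg (Finset.compl_subset_compl.2 hS)
      fun i _ _ => hw.nonneg i
  calc (dv + 1 : ℝ) * ∑ i ∈ S, w i ≤ (dv + 1 : ℝ) * ∑ i ∈ S', w i := by gcongr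
    _ ≤ dv * ∑ i ∈ S'ᶜ, w i := h w hw
    _ ≤ dv * ∑ i ∈ Sᶜ, w i := by gcongr

/-- This is the source of every uniqueness claim: optimality of a point yields `hle` for its error
vector, and the strict gap then leaves only zero. -/
theorem Robust.eq_zero {H : Matrix (Fin m) (Fin n) (ZMod 2)} {dv : ℕ} {S : Finset (Fin n)}
    (h : Robust H dv S) {w : Fin n → ℝ} (hw : InCone H w)
    (hle : ∑ i ∈ Sᶜ, w i ≤ ∑ i ∈ S, w i) : ∀ i, w i = 0 := by
  have h1 := h w hw
  have h2 : (dv : ℝ) * ∑ i ∈ Sᶜ, w i ≤ dv * ∑ i ∈ S, w i := by gcongr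
  have h3 : ∑ i, w i ≤ 0 := by
    rw [← Finset.sum_add_sum_compl S]; linarith
  intro i
  have h4 := Finset.single_le_sum (f := w) (fun i _ => hw.nonneg i) (Finset.mem_univ i)
  linarith [hw.nonneg i]

/-! ### From dual certificates to robustness -/

theorem matchingLabel_eq_mul (S : Finset (Fin n)) (M : Finset (Fin n × Fin m)) (x : ℝ)
    (i : Fin n) (j : Fin m) : matchingLabel S M x i j = x * matchingLabel S M 1 i j := by
  unfold matchingLabel; split_ifs <;> simp

theorem exists_int_matchingLabel (S : Finset (Fin n)) (M : Finset (Fin n × Fin m))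
    (i : Fin n) (j : Fin m) : ∃ s : ℤ, -1 ≤ s ∧ (s : ℝ) = matchingLabel S M 1 i j := by
  unfold matchingLabel
  split_ifs
  exacts [⟨-1, by simp⟩, ⟨1, by simp⟩, ⟨0, by simp⟩]

/-- The labels at a check node pair nonnegatively with the fundamental cone. -/
theorem InCone.sum_matchingLabel_nonneg {H : Matrix (Fin m) (Fin n) (ZMod 2)} {w : Fin n → ℝ}
    (hw : InCone H w) {M : Finset (Fin n × Fin m)} (hM : IsCheckMatching H M)
    (S : Finset (Fin n)) (j : Fin m) :
    0 ≤ ∑ i ∈ Finset.univ.filter (fun i => H j i ≠ 0), matchingLabel S M 1 i j * w i := by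
  by_cases h : ∃ i' ∈ S, (i', j) ∈ M
  · obtain ⟨i₀, hi₀, hM₀⟩ := h
    have hH : H j i₀ ≠ 0 := hM.1 _ hM₀
    -- Only `i₀` is matched to `j`, so the sum is exactly the cone inequality at `(j, i₀)`.
    rw [← Finset.add_sum_erase _ _ (show i₀ ∈ Finset.univ.filter (fun i => H j i ≠ 0) by simpa)]
    have h1 : matchingLabel S M 1 i₀ j = -1 := by simp [matchingLabel, hi₀, hM₀]
    have h2 : ∀ i ∈ (Finset.univ.filter (fun i => H j i ≠ 0)).erase i₀,
        matchingLabel S M 1 i j * w i = w i := by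
      intro i hi
      have hne : ¬ (i ∈ S ∧ (i, j) ∈ M) := fun hc =>
        (Finset.ne_of_mem_erase hi) (congrArg Prod.fst (hM.2 _ hc.2 _ hM₀ rfl))
      have hex : ∃ i' ∈ S, (i', j) ∈ M := ⟨i₀, hi₀, hM₀⟩
      simp [matchingLabel, hne, hex]
    rw [Finset.sum_congr rfl h2, h1]
    linarith [hw.check j i₀ hH]
  · apply Finset.sum_nonneg
    intro i _
    have hne : ¬ (i ∈ S ∧ (i, j) ∈ M) := fun hc => h ⟨i, hc⟩
    simp [matchingLabel, hne, h]

/-- Integrality upgrades the strict dual inequalities to a uniform gap: no integer lies strictly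
between `K` and `K + 1`, and the degree bounds `K`. -/
theorem robust_of_dualFeasible {H : Matrix (Fin m) (Fin n) (ZMod 2)} {dv : ℕ}
    (hreg : VariableRegular H dv) {S : Finset (Fin n)} {M : Finset (Fin n × Fin m)} {x : ℝ}
    (hx : 0 < x) (hM : IsCheckMatching H M)
    (hf : DualFeasible H (likelihood S) (matchingLabel S M x)) : Robust H dv S := by
  intro w hw
  rcases S.eq_empty_or_nonempty with rfl | ⟨i₀, hi₀⟩
  · simpa using mul_nonneg (Nat.cast_nonneg dv) (Finset.sum_nonneg fun i _ => hw.nonneg i)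
  choose s hs1 hs using exists_int_matchingLabel S M
  set σ : Fin n → ℤ := fun i => ∑ j ∈ checksOf H i, s i j with hσ
  have hσr : ∀ i, (σ i : ℝ) = ∑ j ∈ checksOf H i, matchingLabel S M 1 i j := by
    intro i; simp [hσ, hs]
  have hlt : ∀ i, x * σ i < likelihood S i := by
    intro i
    have := hf.variable_lt i
    rwa [hσr, Finset.mul_sum, ← Finset.sum_congr rfl fun j _ => matchingLabel_eq_mul S M x i j]
  -- With `σ i₀ ≤ -(K + 1)` this bounds `K`; a node of `S` is needed here, so the empty set was
  -- split off.
  have hlow : -(dv : ℤ) ≤ σ i₀ := by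
    have : ∑ j ∈ checksOf H i₀, (-1 : ℤ) ≤ σ i₀ := Finset.sum_le_sum fun j _ => hs1 i₀ j
    simpa [hreg i₀] using this
  set K : ℤ := ⌈x⁻¹⌉ - 1 with hK
  have hon : ∀ i ∈ S, σ i ≤ -(K + 1) := by
    intro i hi
    have h1 := hlt i
    simp only [likelihood, hi, if_true] at h1
    have h2 : x⁻¹ ≤ ((-σ i : ℤ) : ℝ) := by
      rw [inv_le_iff_one_le_mul₀' hx]; push_cast; linarith
    have := Int.ceil_le.2 h2
    omega
  have hoff : ∀ i ∉ S, σ i ≤ K := by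
    intro i hi
    have h1 := hlt i
    simp only [likelihood, hi, if_false] at h1
    have h2 : (σ i : ℝ) < x⁻¹ := by
      rw [← mul_lt_mul_iff_right₀ hx, mul_inv_cancel₀ hx.ne']; exact h1
    have := Int.lt_ceil.2 h2
    omega
  have hK0 : 0 ≤ K := by
    have := Int.ceil_pos.2 (inv_pos.2 hx); omega
  have hKd : K ≤ dv := by have := hon i₀ hi₀; omega
  have hpair : 0 ≤ ∑ i, (σ i : ℝ) * w i := by
    have : ∑ i, (σ i : ℝ) * w i = ∑ j, ∑ i ∈ Finset.univ.filter (fun i => H j i ≠ 0),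
        matchingLabel S M 1 i j * w i := by
      simp_rw [hσr, Finset.sum_mul, checksOf, Finset.sum_filter]
      exact Finset.sum_comm
    rw [this]
    exact Finset.sum_nonneg fun j _ => hw.sum_matchingLabel_nonneg hM S j
  rw [← Finset.sum_add_sum_compl S] at hpair
  have h1 : ∑ i ∈ S, (σ i : ℝ) * w i ≤ -(K + 1) * ∑ i ∈ S, w i := by
    rw [Finset.mul_sum]
    refine Finset.sum_le_sum fun i hi => mul_le_mul_of_nonneg_right ?_ (hw.nonneg i)
    exact_mod_cast hon i hi
  have h2 : ∑ i ∈ Sᶜ, (σ i : ℝ) * w i ≤ K * ∑ i ∈ Sᶜ, w i := by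
    rw [Finset.mul_sum]
    refine Finset.sum_le_sum fun i hi => mul_le_mul_of_nonneg_right ?_ (hw.nonneg i)
    exact_mod_cast hoff i (Finset.mem_compl.1 hi)
  have hA : 0 ≤ ∑ i ∈ S, w i := Finset.sum_nonneg fun i _ => hw.nonneg i
  have hB : 0 ≤ ∑ i ∈ Sᶜ, w i := Finset.sum_nonneg fun i _ => hw.nonneg i
  set A := ∑ i ∈ S, w i
  set B := ∑ i ∈ Sᶜ, w i
  have hK0' : (0 : ℝ) ≤ K := by exact_mod_cast hK0
  have hKd' : (K : ℝ) ≤ dv := by exact_mod_cast hKd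
  -- This is `(K + 1) A ≤ K B`. If `A ≤ B`, then `K` may be enlarged to `dv`; `B < A` would force `A
  -- ≤ 0` and so `B < 0`.
  have h3 : A ≤ K * (B - A) := by linarith
  rcases le_or_gt A B with h | h
  · have := mul_le_mul_of_nonneg_right hKd' (sub_nonneg.2 h)
    linarith
  · have := mul_nonneg hK0' (sub_pos.2 h).le
    linarith

theorem StrongCertified.robust {H : Matrix (Fin m) (Fin n) (ZMod 2)} {dv : ℕ}
    (hreg : VariableRegular H dv) {S : Finset (Fin n)} (h : StrongCertified H dv S) :
    Robust H dv S := by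
  obtain ⟨δ, x, M, hx, hM, hf⟩ := h
  exact robust_of_dualFeasible hreg hx hM.matching hf

theorem WeakCertified.robust {H : Matrix (Fin m) (Fin n) (ZMod 2)} {dv : ℕ}
    (hreg : VariableRegular H dv) {S : Finset (Fin n)} (h : WeakCertified H dv S) :
    Robust H dv S := by
  obtain ⟨p, q, x, M, hx, -, -, hM, hf⟩ := h
  exact robust_of_dualFeasible hreg hx hM.matching hf

theorem StrongCertified.check_pos {H : Matrix (Fin m) (Fin n) (ZMod 2)} {dv : ℕ}
    {S : Finset (Fin n)} (h : StrongCertified H dv S) (hS : S.Nonempty) : 0 < m := by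
  obtain ⟨i, hi⟩ := hS
  obtain ⟨δ, x, M, hx, hM, hf⟩ := h
  have h1 := hf.variable_lt i
  by_contra hm
  obtain rfl : m = 0 := by omega
  simp [likelihood, hi, checksOf] at h1
  linarith

/-! ### The polytope -/

theorem IsCodeword.mem_polytope {H : Matrix (Fin m) (Fin n) (ZMod 2)} {c : Fin n → ZMod 2}
    (hc : IsCodeword H c) : toReal c ∈ polytope H :=
  Set.mem_iInter.2 fun j => subset_convexHull ℝ _ ⟨c, congrFun hc j, rfl⟩

theorem zmod_two_eq (a : ZMod 2) : a = 0 ∨ a = 1 := by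
  revert a; decide

theorem toReal_eq (c : Fin n → ZMod 2) (i : Fin n) : toReal c i = 0 ∨ toReal c i = 1 := by
  rcases zmod_two_eq (c i) with h | h <;> simp [toReal, h, ZMod.val_one]

/-- Without check nodes the intersection is empty and the polytope is all of `ℝⁿ`; hence `hm`. -/
theorem polytope_subset_Icc {H : Matrix (Fin m) (Fin n) (ZMod 2)} (hm : 0 < m)
    {x : Fin n → ℝ} (hx : x ∈ polytope H) (i : Fin n) : 0 ≤ x i ∧ x i ≤ 1 := by
  have h1 := Set.mem_iInter.1 hx ⟨0, hm⟩
  have h2 : convexHull ℝ (toReal '' {c : Fin n → ZMod 2 | H ⟨0, hm⟩ ⬝ᵥ c = 0}) ⊆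
      Set.Icc (0 : Fin n → ℝ) 1 := by
    refine convexHull_min ?_ (convex_Icc _ _)
    rintro _ ⟨c, -, rfl⟩
    constructor <;> intro i <;> rcases toReal_eq c i with h | h <;> simp [h]
  exact ⟨(h2 h1).1 i, (h2 h1).2 i⟩

theorem isCompact_polytope {H : Matrix (Fin m) (Fin n) (ZMod 2)} (hm : 0 < m) :
    IsCompact (polytope H) := by
  have hc : ∀ j, IsCompact (convexHull ℝ (toReal '' {c : Fin n → ZMod 2 | H j ⬝ᵥ c = 0})) :=
    fun j => ((Set.toFinite _).image _).isCompact_convexHull ℝ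
  exact (hc ⟨0, hm⟩).of_isClosed_subset (isClosed_iInter fun j => (hc j).isClosed)
    (Set.iInter_subset _ _)

/-- The error vector of a point of the polytope lies in the fundamental cone. -/
theorem inCone_abs_sub {H : Matrix (Fin m) (Fin n) (ZMod 2)} (hm : 0 < m) {x : Fin n → ℝ}
    (hx : x ∈ polytope H) {c : Fin n → ZMod 2} (hc : IsCodeword H c) :
    InCone H (fun i => |x i - toReal c i|) := by
  refine ⟨fun i => abs_nonneg _, fun j i hi => ?_⟩
  -- On `[0, 1]` the distance to a bit is affine, so the cone inequality need only be checked at the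
  -- binary words satisfying check `j`.
  set f : Fin n → ℝ → ℝ := fun i a => toReal c i + (1 - 2 * toReal c i) * a with hf
  have hfx : ∀ x ∈ Set.Icc (0 : ℝ) 1, ∀ i, f i x = |x - toReal c i| := by
    intro x hx i
    rcases toReal_eq c i with h | h
    · simp [hf, h, abs_of_nonneg hx.1]
    · simp only [hf, h]; rw [abs_of_nonpos (by linarith [hx.2])]; ring
  set F := (Finset.univ.filter fun i' => H j i' ≠ 0).erase i with hF
  have hconv : Convex ℝ {z : Fin n → ℝ | f i (z i) ≤ ∑ i' ∈ F, f i' (z i')} := by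
    intro u hu v hv a b ha hb hab
    simp only [Set.mem_ofPred_eq] at *
    have key : ∀ k, f k ((a • u + b • v) k) = a * f k (u k) + b * f k (v k) := by
      intro k
      simp only [hf, Pi.add_apply, Pi.smul_apply, smul_eq_mul]
      linear_combination (-(toReal c k)) * hab
    simp_rw [key, Finset.sum_add_distrib, ← Finset.mul_sum]
    gcongr
  have hsub : convexHull ℝ (toReal '' {c : Fin n → ZMod 2 | H j ⬝ᵥ c = 0}) ⊆
      {z : Fin n → ℝ | f i (z i) ≤ ∑ i' ∈ F, f i' (z i')} := by
    refine convexHull_min ?_ hconv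
    rintro _ ⟨c', hc', rfl⟩
    have hval : ∀ k, f k (toReal c' k) = (((c' + c) k).val : ℝ) := by
      intro k
      simp only [hf, toReal, Pi.add_apply]
      rcases zmod_two_eq (c k) with h | h <;> rcases zmod_two_eq (c' k) with h' | h' <;>
        rw [h, h']
      · simp
      · simp [ZMod.val_one]
      · simp [ZMod.val_one]
      · rw [show ((1 : ZMod 2) + 1) = 0 from rfl, ZMod.val_one, ZMod.val_zero]; norm_num
    simp only [Set.mem_ofPred_eq, hval]
    -- The difference of two words satisfying check `j` has even weight there, so a one at `i` is
    -- accompanied by another.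
    have hsum : ∑ k ∈ Finset.univ.filter (fun i' => H j i' ≠ 0), (c' + c) k = 0 := by
      have h0 : H j ⬝ᵥ (c' + c) = 0 := by
        rw [dotProduct_add, show H j ⬝ᵥ c = 0 from congrFun hc j, add_zero]; exact hc'
      refine Eq.trans ?_ h0
      rw [dotProduct, Finset.sum_filter]
      refine Finset.sum_congr rfl fun k _ => ?_
      rcases zmod_two_eq (H j k) with h | h <;> simp [h]
    rw [← Finset.add_sum_erase _ _
      (show i ∈ Finset.univ.filter (fun i' => H j i' ≠ 0) by simpa)] at hsum
    rcases zmod_two_eq ((c' + c) i) with h | h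
    · rw [h, ZMod.val_zero, Nat.cast_zero]
      exact Finset.sum_nonneg fun k _ => Nat.cast_nonneg _
    · rw [h] at hsum ⊢
      obtain ⟨k, hk, hk1⟩ : ∃ k ∈ F, (c' + c) k ≠ 0 := by
        by_contra! hcon
        rw [Finset.sum_eq_zero hcon] at hsum
        simp at hsum
      have hk1' : (c' + c) k = 1 := (zmod_two_eq _).resolve_left hk1
      have := Finset.single_le_sum (f := fun k => (((c' + c) k).val : ℝ))
        (fun k _ => Nat.cast_nonneg _) hk
      simpa only [hk1', ZMod.val_one] using this
  have h1 := hsub (Set.mem_iInter.1 hx j)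
  have hI := fun k => polytope_subset_Icc hm hx k
  simp only [Set.mem_ofPred_eq] at h1
  simpa only [fun k => hfx (x k) (hI k) k] using h1

/-! ### Optimality of the two linear programs -/

theorem abs_sub_received (c : Fin n → ZMod 2) (S : Finset (Fin n)) {x : Fin n → ℝ} {i : Fin n}
    (hx : 0 ≤ x i ∧ x i ≤ 1) :
    |(x - toReal (received c S)) i| =
      if i ∈ S then 1 - |x i - toReal c i| else |x i - toReal c i| := by
  by_cases hi : i ∈ S
  · simp only [Pi.sub_apply, toReal, received, hi, if_true]
    rcases zmod_two_eq (c i) with h | h <;> rw [h]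
    · rw [zero_add, ZMod.val_one, ZMod.val_zero, Nat.cast_one, Nat.cast_zero, sub_zero,
        abs_of_nonneg hx.1, abs_of_nonpos (by linarith)]
      ring
    · rw [show ((1 : ZMod 2) + 1) = 0 from rfl, ZMod.val_one, ZMod.val_zero, Nat.cast_one,
        Nat.cast_zero, sub_zero, abs_of_nonneg hx.1, abs_of_nonpos (by linarith)]
      ring
  · simp [toReal, received, hi]

theorem l1On_sub_received (c : Fin n → ZMod 2) (S A : Finset (Fin n)) {x : Fin n → ℝ}
    (hx : ∀ i, 0 ≤ x i ∧ x i ≤ 1) :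
    l1On A (x - toReal (received c S)) = l1On A (toReal c - toReal (received c S)) +
      (∑ i ∈ A \ S, |x i - toReal c i| - ∑ i ∈ A ∩ S, |x i - toReal c i|) := by
  have hc : ∀ i, 0 ≤ toReal c i ∧ toReal c i ≤ 1 := by
    intro i; rcases toReal_eq c i with h | h <;> simp [h]
  unfold l1On
  rw [Finset.sum_congr rfl fun i _ => abs_sub_received c S (hx i),
    Finset.sum_congr rfl fun i _ => abs_sub_received c S (hc i),
    ← Finset.sum_inter_add_sum_sdiff A S, ← Finset.sum_inter_add_sum_sdiff A S,
    Finset.sum_congr rfl fun i hi => if_pos (Finset.mem_inter.1 hi).2,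
    Finset.sum_congr rfl fun i hi => if_neg (Finset.mem_sdiff.1 hi).2,
    Finset.sum_congr rfl fun i hi => if_pos (Finset.mem_inter.1 hi).2,
    Finset.sum_congr rfl fun i hi => if_neg (Finset.mem_sdiff.1 hi).2]
  simp only [sub_self, abs_zero, Finset.sum_sub_distrib, Finset.sum_const_zero]
  ring

theorem continuous_l1On_sub (A : Finset (Fin n)) (y : Fin n → ℝ) :
    Continuous fun x : Fin n → ℝ => l1On A (x - y) := by
  unfold l1On
  fun_prop

theorem minimizers_nonempty {H : Matrix (Fin m) (Fin n) (ZMod 2)} (hm : 0 < m)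
    {c : Fin n → ZMod 2} (hc : IsCodeword H c) {f : (Fin n → ℝ) → ℝ} (hf : Continuous f) :
    (minimizers (polytope H) f).Nonempty := by
  obtain ⟨x, hx, hmin⟩ := (isCompact_polytope hm).exists_isMinOn ⟨_, hc.mem_polytope⟩ hf.continuousOn
  exact ⟨x, hx, fun z hz => hmin hz⟩

theorem exists_isLargestEntries (ℓ : ℕ) (d : Fin n → ℝ) : ∃ L, IsLargestEntries ℓ d L := by
  have key : ∀ k ≤ n, ∃ L : Finset (Fin n), L.card = k ∧ ∀ i ∈ L, ∀ j ∉ L, |d j| ≤ |d i| := by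
    intro k
    induction k with
    | zero => exact fun _ => ⟨∅, by simp⟩
    | succ k ih =>
      intro hk
      obtain ⟨L, hL, hmax⟩ := ih (by omega)
      have hne : (Lᶜ).Nonempty := by
        rw [← Finset.card_pos, Finset.card_compl, Fintype.card_fin]; omega
      obtain ⟨a, ha, hamax⟩ := Finset.exists_max_image Lᶜ (fun i => |d i|) hne
      rw [Finset.mem_compl] at ha
      refine ⟨insert a L, by rw [Finset.card_insert_of_notMem ha, hL], ?_⟩
      intro i hi j hj
      have hj' : j ∉ L := fun h => hj (Finset.mem_insert_of_mem h)
      rcases Finset.mem_insert.1 hi with rfl | hi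
      · exact hamax j (Finset.mem_compl.2 hj')
      · exact hmax i hi j hj'
  exact key _ (min_le_right _ _)

/-- If the weighted errors lie on few positions, the reweighted program recovers the codeword. -/
theorem weightedSolutions_eq {H : Matrix (Fin m) (Fin n) (ZMod 2)} (hm : 0 < m) {dv : ℕ}
    {c : Fin n → ZMod 2} (hc : IsCodeword H c) {S L : Finset (Fin n)}
    (hR : Robust H dv (symmDiff L S)) :
    weightedSolutions H (-1) 1 L (toReal (received c S)) = {toReal c} := by
  have huniq : ∀ x ∈ weightedSolutions H (-1) 1 L (toReal (received c S)), x = toReal c := by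
    rintro x ⟨hx, hmin⟩
    have hcone := inCone_abs_sub hm hx hc
    have h1 := hmin _ hc.mem_polytope
    simp only [l1On_sub_received c S _ (polytope_subset_Icc hm hx)] at h1
    -- The weight -1 swaps the roles of `S` and its complement inside `L`, so the error mass counts
    -- negatively exactly on `L ∆ S`.
    have h2 : ∑ i ∈ symmDiff L S, |x i - toReal c i| =
        ∑ i ∈ L \ S, |x i - toReal c i| + ∑ i ∈ Lᶜ ∩ S, |x i - toReal c i| := by
      rw [← Finset.sum_union]
      · congr 1; ext i; simp [Finset.mem_symmDiff, and_comm]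
      · rw [Finset.disjoint_left]; intro i; simp +contextual
    have h3 : ∑ i ∈ (symmDiff L S)ᶜ, |x i - toReal c i| =
        ∑ i ∈ L ∩ S, |x i - toReal c i| + ∑ i ∈ Lᶜ \ S, |x i - toReal c i| := by
      rw [← Finset.sum_union]
      · congr 1; ext i; simp; tauto
      · rw [Finset.disjoint_left]; intro i; simp +contextual
    have h4 := hR.eq_zero hcone (by rw [h2, h3]; linarith)
    funext i
    exact sub_eq_zero.1 (abs_eq_zero.1 (h4 i))
  obtain ⟨x, hx⟩ := minimizers_nonempty hm hc
    (f := fun x => -1 * l1On L (x - toReal (received c S)) +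
      1 * l1On Lᶜ (x - toReal (received c S)))
    ((continuous_const.mul (continuous_l1On_sub _ _)).add
      (continuous_const.mul (continuous_l1On_sub _ _)))
  exact Set.eq_singleton_iff_nonempty_unique_mem.2 ⟨⟨x, hx⟩, huniq⟩

theorem lpSolutions_sum_le {H : Matrix (Fin m) (Fin n) (ZMod 2)} (hm : 0 < m)
    {c : Fin n → ZMod 2} (hc : IsCodeword H c) {S : Finset (Fin n)} {x : Fin n → ℝ}
    (hx : x ∈ lpSolutions H (toReal (received c S))) :
    ∑ i ∈ Sᶜ, |x i - toReal c i| ≤ ∑ i ∈ S, |x i - toReal c i| := by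
  obtain ⟨hx, hmin⟩ := hx
  have h1 := hmin _ hc.mem_polytope
  simp only [l1On_sub_received c S _ (polytope_subset_Icc hm hx), Finset.univ_inter,
    ← Finset.compl_eq_univ_sdiff] at h1
  linarith

/-! ### Criteria for the two-step decoder to succeed -/

theorem isIntegral_toReal (c : Fin n → ZMod 2) : IsIntegral (toReal c) := toReal_eq c

/-- To correct `S` it suffices that, for every solution of the first program, an integral solution
is the codeword, and otherwise the second program has the codeword as its only solution. -/
theorem corrects_of_forall {H : Matrix (Fin m) (Fin n) (ZMod 2)} (hm : 0 < m) {ℓ : ℕ}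
    {lam₁ lam₂ : ℝ} {S : Finset (Fin n)}
    (h : ∀ c, IsCodeword H c → ∀ x ∈ lpSolutions H (toReal (received c S)),
      (IsIntegral x → x = toReal c) ∧
      (¬ IsIntegral x → ∀ L, IsLargestEntries ℓ (toReal (received c S) - x) L →
        weightedSolutions H lam₁ lam₂ L (toReal (received c S)) = {toReal c})) :
    Corrects H ℓ lam₁ lam₂ S := by
  intro c hc
  refine Set.eq_singleton_iff_nonempty_unique_mem.2 ⟨?_, ?_⟩
  · obtain ⟨x, hx⟩ := minimizers_nonempty hm hc
      (continuous_l1On_sub Finset.univ (toReal (received c S)))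
    by_cases hi : IsIntegral x
    · exact ⟨x, x, hx, Or.inl ⟨hi, rfl⟩⟩
    · obtain ⟨L, hL⟩ := exists_isLargestEntries ℓ (toReal (received c S) - x)
      refine ⟨toReal c, x, hx, Or.inr ⟨hi, L, hL, ?_⟩⟩
      rw [(h c hc x hx).2 hi L hL]
      rfl
  · rintro z ⟨x, hx, ⟨hi, rfl⟩ | ⟨hi, L, hL, hz⟩⟩
    · exact (h c hc z hx).1 hi
    · rw [(h c hc x hx).2 hi L hL] at hz
      exact hz

theorem Robust.corrects {H : Matrix (Fin m) (Fin n) (ZMod 2)} (hm : 0 < m) {dv : ℕ}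
    {S : Finset (Fin n)} (hR : Robust H dv S) (ℓ : ℕ) (lam₁ lam₂ : ℝ) :
    Corrects H ℓ lam₁ lam₂ S := by
  refine corrects_of_forall hm fun c hc x hx => ?_
  have h0 := hR.eq_zero (inCone_abs_sub hm hx.1 hc) (lpSolutions_sum_le hm hc hx)
  have hxc : x = toReal c := funext fun i => sub_eq_zero.1 (abs_eq_zero.1 (h0 i))
  exact ⟨fun _ => hxc, fun hi => absurd (hxc ▸ isIntegral_toReal c) hi⟩

/-- The objective of the first program vanishes only at the codeword, whatever the polytope; this
settles a zero strong threshold, even without check nodes. -/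
theorem corrects_empty (H : Matrix (Fin m) (Fin n) (ZMod 2)) (ℓ : ℕ) (lam₁ lam₂ : ℝ) :
    Corrects H ℓ lam₁ lam₂ ∅ := by
  intro c hc
  have hy : received c ∅ = c := by funext i; simp [received]
  have hlp : lpSolutions H (toReal c) = {toReal c} := by
    refine Set.eq_singleton_iff_unique_mem.2 ⟨⟨hc.mem_polytope, fun z _ => ?_⟩, ?_⟩
    · simpa [l1On] using Finset.sum_nonneg fun i _ => abs_nonneg (z i - toReal c i)
    · rintro x ⟨-, hmin⟩
      have h1 := hmin _ hc.mem_polytope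
      simp only [l1On, sub_self, Pi.zero_apply, abs_zero, Finset.sum_const_zero] at h1
      have h2 := (Finset.sum_eq_zero_iff_of_nonneg fun i _ => abs_nonneg _).1
        (le_antisymm h1 (Finset.sum_nonneg fun i _ => abs_nonneg _))
      exact funext fun i => sub_eq_zero.1 (abs_eq_zero.1 (h2 i (Finset.mem_univ i)))
  rw [hy, decoderOutputs, hlp]
  ext z
  simp [isIntegral_toReal c]

/-! ### Error sets beyond the threshold -/

theorem card_filter_half_le (w : Fin n → ℝ) (hw : ∀ i, 0 ≤ w i) :
    ((Finset.univ.filter fun i => 1 / 2 ≤ w i).card : ℝ) ≤ 2 * ∑ i, w i := by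
  have h1 : ∑ i ∈ Finset.univ.filter (fun i => 1 / 2 ≤ w i), (1 / 2 : ℝ) ≤
      ∑ i ∈ Finset.univ.filter (fun i => 1 / 2 ≤ w i), w i :=
    Finset.sum_le_sum fun i hi => (Finset.mem_filter.1 hi).2
  have h2 : ∑ i ∈ Finset.univ.filter (fun i => 1 / 2 ≤ w i), w i ≤ ∑ i, w i :=
    Finset.sum_le_sum_of_subset_of_nonneg (Finset.filter_subset _ _) fun i _ _ => hw i
  rw [Finset.sum_const, nsmul_eq_mul] at h1
  linarith

/-- An LP solution is close to the codeword if most of the error set is robust. -/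
theorem sum_abs_sub_le {H : Matrix (Fin m) (Fin n) (ZMod 2)} (hm : 0 < m) {dv : ℕ}
    {c : Fin n → ZMod 2} (hc : IsCodeword H c) {S S' : Finset (Fin n)} (hS : S' ⊆ S)
    (hR : Robust H dv S') {x : Fin n → ℝ} (hx : x ∈ lpSolutions H (toReal (received c S))) :
    ∑ i, |x i - toReal c i| ≤ 2 * (2 * dv + 1) * ((S \ S').card : ℝ) := by
  have h1 := lpSolutions_sum_le hm hc hx
  have h2 := hR _ (inCone_abs_sub hm hx.1 hc)
  have hle : ∀ i, |x i - toReal c i| ≤ 1 := by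
    intro i
    have := polytope_subset_Icc hm hx.1 i
    rcases toReal_eq c i with h | h <;> rw [h, abs_le] <;> constructor <;> linarith
  set w : Fin n → ℝ := fun i => |x i - toReal c i| with hw
  have hT : ∑ i ∈ S \ S', w i ≤ ((S \ S').card : ℝ) := by
    simpa using Finset.sum_le_card_nsmul (S \ S') w 1 fun i _ => hle i
  have h3 : ∑ i ∈ S, w i = ∑ i ∈ S \ S', w i + ∑ i ∈ S', w i := (Finset.sum_sdiff hS).symm
  have h4 := Finset.sum_add_sum_compl S w
  have h5 := Finset.sum_add_sum_compl S' w
  change _ ≤ ∑ i ∈ S, w i at h1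
  change (dv + 1 : ℝ) * ∑ i ∈ S', w i ≤ dv * ∑ i ∈ S'ᶜ, w i at h2
  change ∑ i, w i ≤ _
  change ∑ i ∈ Sᶜ, w i ≤ _ at h1
  set T := ∑ i ∈ S \ S', w i
  set B := ∑ i ∈ S', w i
  have h6 : ∑ i ∈ S'ᶜ, w i ≤ B + 2 * T := by linarith
  have h7 : (dv : ℝ) * ∑ i ∈ S'ᶜ, w i ≤ dv * (B + 2 * T) := by gcongr
  have h8 : (2 * dv + 1 : ℝ) * T ≤ (2 * dv + 1) * ((S \ S').card : ℝ) := by gcongr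
  linarith

/-- The largest entries of `y - x` miss few positions of the error set. -/
theorem card_sdiff_largestEntries_le {c : Fin n → ZMod 2} {S L : Finset (Fin n)} {x : Fin n → ℝ}
    (hx : ∀ i, 0 ≤ x i ∧ x i ≤ 1) {ℓ : ℕ} (hSℓ : S.card ≤ ℓ)
    (hL : IsLargestEntries ℓ (toReal (received c S) - x) L) :
    ((S \ L).card : ℝ) ≤ 2 * ∑ i, |x i - toReal c i| := by
  refine le_trans ?_ (card_filter_half_le (fun i => |x i - toReal c i|) fun i => abs_nonneg _)
  rw [Nat.cast_le]
  have habs : ∀ i, |(toReal (received c S) - x) i| =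
      if i ∈ S then 1 - |x i - toReal c i| else |x i - toReal c i| := by
    intro i
    rw [← abs_sub_received c S (hx i), Pi.sub_apply, Pi.sub_apply, abs_sub_comm]
  -- A missed `i ∈ S` with error below 1/2 deviates from `y` by more than 1/2, so every position of
  -- `L \ S` has error above 1/2; and `L \ S` is at least as large as `S \ L`.
  by_cases h : ∃ i ∈ S \ L, |x i - toReal c i| < 1 / 2
  · obtain ⟨i, hi, hlt⟩ := h
    rw [Finset.mem_sdiff] at hi
    have hcard : S.card ≤ L.card := by
      rw [hL.1]
      exact le_min hSℓ (by simpa using S.card_le_univ)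
    refine (Finset.card_sdiff_le_card_sdiff_iff.2 hcard).trans (Finset.card_le_card fun k hk => ?_)
    rw [Finset.mem_sdiff] at hk
    have h1 := hL.2 k hk.1 i hi.2
    rw [habs, habs, if_pos hi.1, if_neg hk.2] at h1
    simp only [Finset.mem_filter, Finset.mem_univ, true_and]
    linarith
  · push Not at h
    exact Finset.card_le_card fun i hi => by simpa using h i hi

/-- The constant 8 is a product of three factors 2: from `sum_abs_sub_le`, from the threshold 1/2 in
`card_sdiff_largestEntries_le`, and from `|L ∆ S| = |L| - |S| + 2 |S \ L|`. -/
theorem corrects_of_subset_robust {H : Matrix (Fin m) (Fin n) (ZMod 2)} (hm : 0 < m) {dv r : ℕ}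
    (hr : ∀ U : Finset (Fin n), U.card ≤ r → Robust H dv U) {S S' : Finset (Fin n)} (hS : S' ⊆ S)
    (hR : Robust H dv S') {ℓ : ℕ} (hSℓ : S.card ≤ ℓ)
    (hℓ : ℓ + 8 * (2 * dv + 1) * (S \ S').card ≤ r + S.card) :
    Corrects H ℓ (-1) 1 S := by
  refine corrects_of_forall hm fun c hc x hx => ?_
  have hI := polytope_subset_Icc hm hx.1
  have hsum := sum_abs_sub_le hm hc hS hR hx
  have hcone := inCone_abs_sub hm hx.1 hc
  constructor
  · intro hi
    -- An integral solution could be a wrong word. Its error is supported on `U`, which is small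
    -- enough to be robust, so the error vanishes.
    set U := Finset.univ.filter fun i => 1 / 2 ≤ |x i - toReal c i| with hU
    have hUr : U.card ≤ r := by
      have h1 := (card_filter_half_le (fun i => |x i - toReal c i|) fun i => abs_nonneg _).trans
        (mul_le_mul_of_nonneg_left hsum zero_le_two)
      have h2 : U.card ≤ 2 * (2 * (2 * dv + 1) * (S \ S').card) := by exact_mod_cast h1
      nlinarith [Nat.zero_le ((2 * dv + 1) * (S \ S').card)]
    have h0 := (hr U hUr).eq_zero hcone (by
      rw [Finset.sum_eq_zero (s := Uᶜ)]
      · exact Finset.sum_nonneg fun i _ => abs_nonneg _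
      · intro i hiU
        simp only [hU, Finset.mem_compl, Finset.mem_filter, Finset.mem_univ, true_and,
          not_le] at hiU
        rcases hi i with h | h <;> rcases toReal_eq c i with h' | h' <;> rw [h, h'] at hiU ⊢ <;>
          first | (norm_num at hiU; done) | norm_num)
    exact funext fun i => sub_eq_zero.1 (abs_eq_zero.1 (h0 i))
  · intro _ L hL
    refine weightedSolutions_eq hm hc (hr _ ?_)
    have h1 := (card_sdiff_largestEntries_le hI hSℓ hL).trans
        (mul_le_mul_of_nonneg_left hsum zero_le_two)
    have h2 : (S \ L).card ≤ 2 * (2 * (2 * dv + 1) * (S \ S').card) := by exact_mod_cast h1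
    have h3 : L.card ≤ ℓ := hL.1 ▸ min_le_left _ _
    have h4 : (symmDiff L S).card ≤ (L \ S).card + (S \ L).card := Finset.card_union_le _ _
    have h5 := Finset.card_sdiff_add_card_inter L S
    have h6 := Finset.card_sdiff_add_card_inter S L
    rw [Finset.inter_comm] at h6
    nlinarith [Nat.zero_le ((2 * dv + 1) * (S \ S').card)]

/-! ### Comparing fractions on two levels of the Boolean lattice -/

theorem failFraction_nonneg (n k : ℕ) (Q : Finset (Fin n) → Prop) : 0 ≤ failFraction n k Q := by
  unfold failFraction; positivity

theorem failFraction_eq_zero_of_lt {n k : ℕ} (h : n < k) (Q : Finset (Fin n) → Prop) :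
    failFraction n k Q = 0 := by
  simp [failFraction, Nat.choose_eq_zero_of_lt h]

theorem card_supersets {a b : ℕ} (hab : a ≤ b) {A : Finset (Fin n)} (hA : A.card = a) :
    ((Finset.univ.powersetCard b).filter fun B => A ⊆ B).card = (n - a).choose (b - a) := by
  have h : (Aᶜ.powersetCard (b - a)).card = (n - a).choose (b - a) := by
    rw [Finset.card_powersetCard, Finset.card_compl, Fintype.card_fin, hA]
  rw [← h]
  refine Finset.card_nbij' (fun B => B \ A) (fun C => A ∪ C) ?_ ?_ ?_ ?_
  · intro B hB
    simp only [Finset.coe_filter, Finset.mem_powersetCard_univ, Set.mem_ofPred_eq] at hB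
    simp only [Finset.mem_coe, Finset.mem_powersetCard]
    refine ⟨fun i hi => Finset.mem_compl.2 (Finset.mem_sdiff.1 hi).2, ?_⟩
    rw [Finset.card_sdiff_of_subset hB.2, hB.1, hA]
  · intro C hC
    simp only [Finset.mem_coe, Finset.mem_powersetCard] at hC
    simp only [Finset.coe_filter, Finset.mem_powersetCard_univ, Set.mem_ofPred_eq]
    have hd : Disjoint A C := Finset.disjoint_left.2 fun i hi hiC =>
      Finset.mem_compl.1 (hC.1 hiC) hi
    exact ⟨by rw [Finset.card_union_of_disjoint hd, hA, hC.2]; omega, Finset.subset_union_left⟩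
  · intro B hB
    simp only [Finset.coe_filter, Set.mem_ofPred_eq] at hB
    exact Finset.union_sdiff_of_subset hB.2
  · intro C hC
    simp only [Finset.mem_coe, Finset.mem_powersetCard] at hC
    ext i
    have := @hC.1 i
    simp only [Finset.mem_compl] at this
    simp only [Finset.mem_sdiff, Finset.mem_union]
    tauto

theorem card_subsets {a : ℕ} (B : Finset (Fin n)) :
    ((Finset.univ.powersetCard a).filter fun A => A ⊆ B).card = B.card.choose a := by
  rw [← Finset.card_powersetCard]
  congr 1
  ext A
  simp [Finset.mem_powersetCard, and_comm]

-- Double counting of inclusions: a failing `B` has only failing `a`-subsets, and `C(n,b) C(b,a) =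
-- C(n,a) C(n-a,b-a)` turns the count into fractions.
open Classical in
theorem failFraction_le_of_subsets_fail {a b : ℕ} (hab : a ≤ b) (hb : b ≤ n)
    {Q R : Finset (Fin n) → Prop}
    (h : ∀ A B : Finset (Fin n), A.card = a → B.card = b → A ⊆ B → Q A → R B) :
    failFraction n b R ≤ failFraction n a Q := by
  have hc := Finset.card_mul_le_card_mul (fun B A : Finset (Fin n) => A ⊆ B)
    (s := (Finset.univ.powersetCard b).filter fun S => ¬ R S)
    (t := (Finset.univ.powersetCard a).filter fun S => ¬ Q S)
    (m := b.choose a) (n := (n - a).choose (b - a))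
    (by
      intro B hB
      simp only [Finset.mem_filter, Finset.mem_powersetCard_univ] at hB
      rw [← hB.1, ← card_subsets B]
      refine Finset.card_le_card fun A hA => ?_
      simp only [Finset.mem_filter, Finset.mem_powersetCard_univ,
        Finset.mem_bipartiteAbove] at hA ⊢
      exact ⟨⟨hA.1, fun hq => hB.2 (h A B hA.1 hB.1 hA.2 hq)⟩, hA.2⟩)
    (by
      intro A hA
      simp only [Finset.mem_filter, Finset.mem_powersetCard_univ] at hA
      rw [← card_supersets hab hA.1]
      refine Finset.card_le_card fun B hB => ?_
      simp only [Finset.mem_filter, Finset.mem_powersetCard_univ,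
        Finset.mem_bipartiteBelow] at hB ⊢
      exact ⟨hB.1.1, hB.2⟩)
  have hch := Nat.choose_mul (n := n) hab
  unfold failFraction
  rw [div_le_div_iff₀ (by exact_mod_cast Nat.choose_pos hb)
    (by exact_mod_cast Nat.choose_pos (hab.trans hb))]
  norm_cast
  refine Nat.le_of_mul_le_mul_right ?_ (Nat.choose_pos hab)
  calc _ = _ * b.choose a * n.choose a := by ring
    _ ≤ _ * (n - a).choose (b - a) * n.choose a := Nat.mul_le_mul_right _ hc
    _ = _ * (n.choose a * (n - a).choose (b - a)) := by ring
    _ = _ := by rw [← hch]; ring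

open Classical in
theorem failFraction_le_of_supersets_fail {a b : ℕ} (hab : a ≤ b) (hb : b ≤ n)
    {Q R : Finset (Fin n) → Prop}
    (h : ∀ A B : Finset (Fin n), A.card = a → B.card = b → A ⊆ B → R B → Q A) :
    failFraction n a Q ≤ failFraction n b R := by
  have hc := Finset.card_mul_le_card_mul (fun A B : Finset (Fin n) => A ⊆ B)
    (s := (Finset.univ.powersetCard a).filter fun S => ¬ Q S)
    (t := (Finset.univ.powersetCard b).filter fun S => ¬ R S)
    (m := (n - a).choose (b - a)) (n := b.choose a)
    (by
      intro A hA
      simp only [Finset.mem_filter, Finset.mem_powersetCard_univ] at hA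
      rw [← card_supersets hab hA.1]
      refine Finset.card_le_card fun B hB => ?_
      simp only [Finset.mem_filter, Finset.mem_powersetCard_univ,
        Finset.mem_bipartiteAbove] at hB ⊢
      exact ⟨⟨hB.1, fun hq => hA.2 (h A B hA.1 hB.1 hB.2 hq)⟩, hB.2⟩)
    (by
      intro B hB
      simp only [Finset.mem_filter, Finset.mem_powersetCard_univ] at hB
      rw [← hB.1, ← card_subsets B]
      refine Finset.card_le_card fun A hA => ?_
      simp only [Finset.mem_filter, Finset.mem_powersetCard_univ,
        Finset.mem_bipartiteBelow] at hA ⊢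
      exact ⟨hA.1.1, hA.2⟩)
  have hch := Nat.choose_mul (n := n) hab
  unfold failFraction
  rw [div_le_div_iff₀ (by exact_mod_cast Nat.choose_pos (hab.trans hb))
    (by exact_mod_cast Nat.choose_pos hb)]
  norm_cast
  refine Nat.le_of_mul_le_mul_right ?_ (Nat.choose_pos (Nat.sub_le_sub_right hb a))
  calc _ = _ * (n - a).choose (b - a) * n.choose b := by ring
    _ ≤ _ * b.choose a * n.choose b := Nat.mul_le_mul_right _ hc
    _ = _ * (n.choose b * b.choose a) := by ring
    _ = _ := by rw [hch]; ring

/-! ### Thresholds -/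

theorem sSup_le_one_sep (P : ℝ → Prop) : sSup {p : ℝ | 0 ≤ p ∧ p ≤ 1 ∧ P p} ≤ 1 :=
  Real.sSup_le (fun _ hp => hp.2.1) zero_le_one

theorem weakCertified_empty {m n : ℕ} (H : Matrix (Fin m) (Fin n) (ZMod 2)) (dv : ℕ) :
    WeakCertified H dv ∅ := by
  -- A degree above `dv` is harmless here, as there is no node to be matched.
  refine ⟨dv + 1, 0, 1, ∅, one_pos, Nat.zero_le _, by omega, ⟨⟨?_, ?_⟩, ?_, ?_, ?_⟩, ⟨?_, ?_⟩⟩ <;>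
    simp [nbrs, matchingLabel, likelihood]

theorem floor_mul_le {p : ℝ} (hp : p ≤ 1) (n : ℕ) : ⌊p * n⌋₊ ≤ n := by
  refine Nat.floor_le_of_le ?_
  simpa using mul_le_mul_of_nonneg_right hp (Nat.cast_nonneg n)

/-- The error set `S` is a little larger than a robust subset of density `p`. -/
theorem corrects_of_robust_density {m n dv : ℕ} {H : Matrix (Fin m) (Fin n) (ZMod 2)} (hm : 0 < m)
    {s p₁ q p η : ℝ} (hη : η = s / (72 * (2 * dv + 1))) (hη0 : 0 < η) (hp₁ : s / 2 < p₁)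
    (hr : ∀ U : Finset (Fin n), U.card ≤ ⌊p₁ * n⌋₊ → Robust H dv U)
    (hn : 4 * (9 * (2 * dv + 1) + 1) ≤ s * n)
    (hq : q ≤ 1) (hp : q - η < p) {S S' : Finset (Fin n)} (hS : S' ⊆ S)
    (hR : Robust H dv S') (hS' : S'.card = ⌊p * n⌋₊) (hcard : (S.card : ℝ) ≤ (1 + η) * q * n) :
    Corrects H ⌊(1 + η) * q * n⌋₊ (-1) 1 S := by
  have hSℓ : S.card ≤ ⌊(1 + η) * q * n⌋₊ := Nat.le_floor hcard
  refine corrects_of_subset_robust hm hr hS hR hSℓ ?_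
  have hn0 : (0 : ℝ) ≤ n := Nat.cast_nonneg n
  have h1 : ((⌊(1 + η) * q * n⌋₊ : ℕ) : ℝ) ≤ (1 + η) * q * n :=
    Nat.floor_le ((Nat.cast_nonneg _).trans hcard)
  have h2 : p * n - 1 < (S'.card : ℝ) := by rw [hS']; exact Nat.sub_one_lt_floor _
  have h3 : p₁ * n - 1 < (⌊p₁ * n⌋₊ : ℕ) := Nat.sub_one_lt_floor _
  have h4 : ((S \ S').card : ℝ) = S.card - S'.card := by
    rw [Finset.card_sdiff_of_subset hS, Nat.cast_sub (Finset.card_le_card hS)]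
  have h5 : (S'.card : ℝ) ≤ S.card := by exact_mod_cast Finset.card_le_card hS
  have h6 : (1 + η) * q * n ≤ p * n + 2 * η * n := by
    have : (1 + η) * q ≤ p + 2 * η := by nlinarith
    have := mul_le_mul_of_nonneg_right this hn0
    linarith
  have h7 : s / 2 * n ≤ p₁ * n := by gcongr
  have h8 : 8 * (2 * dv + 1) * ((S \ S').card : ℝ) ≤ 8 * (2 * dv + 1) * (2 * η * n + 1) := by
    rw [h4]; gcongr; linarith
  have h9 : (1 : ℝ) * (2 * η * n + 1) ≤ (2 * dv + 1) * (2 * η * n + 1) := by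
    gcongr
    linarith [(Nat.cast_nonneg dv : (0 : ℝ) ≤ dv)]
  -- The 9 is 8 for `S \ S'` plus 1 for `ℓ - |S|`, each at most `2ηn + 1`. The 72 in `η` makes the
  -- linear term `s n / 4`, half of the available `s n / 2`; `hn` lets the rest absorb the constants
  -- and the floor.
  have h10 : 9 * (2 * dv + 1) * (2 * η * n + 1) = s * n / 4 + 9 * (2 * dv + 1) := by
    rw [hη]; field_simp; ring
  have : ((⌊(1 + η) * q * n⌋₊ : ℕ) : ℝ) + 8 * (2 * dv + 1) * ((S \ S').card : ℝ) ≤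
      (⌊p₁ * n⌋₊ : ℕ) + S.card := by linarith
  exact_mod_cast this

end ReweightedLP

end

/-! ### Choice of the parameters and proof of the theorem -/

open ReweightedLP in
theorem mainTheorem1 (dv : ℕ) (M N : ℕ → ℕ)
    (H : ∀ t, Matrix (Fin (M t)) (Fin (N t)) (ZMod 2))
    (hN : Tendsto N atTop atTop)
    (hreg : ∀ t, ReweightedLP.VariableRegular (H t) dv) :
    ∃ ε₁ ε₂ lam₁ lam₂ : ℝ, 0 < ε₁ ∧ 0 < ε₂ ∧ lam₁ < 0 ∧ 0 < lam₂ ∧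
      (∀ᶠ t in atTop, ∀ S : Finset (Fin (N t)),
        (S.card : ℝ) ≤ (1 + ε₁) * ReweightedLP.strongThreshold dv M N H * N t →
        ReweightedLP.Corrects (H t)
          ⌊(1 + ε₁) * ReweightedLP.strongThreshold dv M N H * N t⌋₊ lam₁ lam₂ S) ∧
      (0 < ReweightedLP.strongThreshold dv M N H →
        ∀ k : ℕ → ℕ,
          (∀ t, (k t : ℝ) ≤ (1 + ε₂) * ReweightedLP.weakThreshold dv M N H * N t) →
          Tendsto (fun t => ReweightedLP.failFraction (N t) (k t)
            (ReweightedLP.Corrects (H t)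
              ⌊(1 + ε₂) * ReweightedLP.weakThreshold dv M N H * N t⌋₊ lam₁ lam₂))
            atTop (𝓝 0)) := by
  have hs0 : 0 ≤ strongThreshold dv M N H := Real.sSup_nonneg fun _ hp => hp.1
  have hs1 : strongThreshold dv M N H ≤ 1 := sSup_le_one_sep _
  have hw1 : weakThreshold dv M N H ≤ 1 := sSup_le_one_sep _
  rcases hs0.eq_or_lt with hs | hs
  · refine ⟨1, 1, -1, 1, one_pos, one_pos, by norm_num, one_pos, ?_, fun h => absurd h (by simp [← hs])⟩
    refine Eventually.of_forall fun t S hS => ?_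
    rw [← hs, mul_zero, zero_mul] at hS
    obtain rfl : S = ∅ := Finset.card_eq_zero.1 (by exact_mod_cast le_antisymm hS (Nat.cast_nonneg _))
    exact corrects_empty _ _ _ _
  set s := strongThreshold dv M N H with hsdef
  set v := weakThreshold dv M N H with hvdef
  obtain ⟨η, hη⟩ : ∃ η, η = s / (72 * (2 * dv + 1)) := ⟨_, rfl⟩
  have hη0 : 0 < η := by rw [hη]; positivity
  have hηs : η ≤ s / 2 := by
    rw [hη]
    gcongr
    linarith [(Nat.cast_nonneg dv : (0 : ℝ) ≤ dv)]
  -- A positive supremum rules out the empty set, whose `sSup` is 0.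
  have hne : {p : ℝ | 0 ≤ p ∧ p ≤ 1 ∧ ∀ᶠ t in atTop, ∀ S : Finset (Fin (N t)),
      S.card = ⌊p * N t⌋₊ → StrongCertified (H t) dv S}.Nonempty := by
    by_contra hcon
    rw [Set.not_nonempty_iff_eq_empty] at hcon
    rw [hsdef, strongThreshold, hcon, Real.sSup_empty] at hs
    exact hs.false
  obtain ⟨p₁, ⟨hp₁0, hp₁1, hp₁⟩, hp₁s⟩ := exists_lt_of_lt_csSup hne (sub_lt_self s hη0)
  have hp₁s' : s / 2 < p₁ := by linarith
  have hgood : ∀ᶠ t in atTop, 0 < M t ∧ 4 * (9 * (2 * dv + 1) + 1) ≤ s * N t ∧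
      ∀ U : Finset (Fin (N t)), U.card ≤ ⌊p₁ * N t⌋₊ → Robust (H t) dv U := by
    have hNr : Tendsto (fun t => s * (N t : ℝ)) atTop atTop :=
      (tendsto_natCast_atTop_atTop.comp hN).const_mul_atTop hs
    filter_upwards [hp₁, hNr.eventually_ge_atTop (4 * (9 * (2 * dv + 1) + 1))] with t ht hNt
    have hfl : ⌊p₁ * N t⌋₊ ≤ N t := floor_mul_le hp₁1 _
    refine ⟨?_, hNt, fun U hU => ?_⟩
    · obtain ⟨S, -, hS⟩ := Finset.exists_subset_card_eq
        (s := (Finset.univ : Finset (Fin (N t)))) (n := ⌊p₁ * N t⌋₊) (by simpa using hfl)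
      refine (ht S hS).check_pos (Finset.card_pos.1 ?_)
      rw [hS, Nat.floor_pos]
      have : s / 2 * N t ≤ p₁ * N t := by gcongr
      linarith [(Nat.cast_nonneg dv : (0 : ℝ) ≤ dv)]
    · obtain ⟨S, hUS, hS⟩ := Finset.exists_superset_card_eq hU (by simpa using hfl)
      exact ((ht S hS).robust (hreg t)).mono hUS
  refine ⟨η, η, -1, 1, hη0, hη0, by norm_num, one_pos, ?_, fun _ k hk => ?_⟩
  · filter_upwards [hgood] with t ⟨hm, hNt, hr⟩ S hS
    rcases le_total S.card ⌊p₁ * N t⌋₊ with h | h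
    · exact (hr S h).corrects hm _ _ _
    · obtain ⟨S', hS', hcard⟩ := Finset.exists_subset_card_eq h
      exact corrects_of_robust_density hm hη hη0 hp₁s' hr hNt hs1 hp₁s hS' (hr S' hcard.le)
        hcard hS
  · have hne' : {p : ℝ | 0 ≤ p ∧ p ≤ 1 ∧ Tendsto (fun t =>
        failFraction (N t) ⌊p * N t⌋₊ (WeakCertified (H t) dv)) atTop (𝓝 0)}.Nonempty := by
      refine ⟨0, le_rfl, zero_le_one, tendsto_const_nhds.congr fun t => ?_⟩
      simp [failFraction, weakCertified_empty, Finset.filter_singleton]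
    obtain ⟨p, ⟨hp0, hp1, hp⟩, hpv⟩ := exists_lt_of_lt_csSup hne' (sub_lt_self v hη0)
    refine tendsto_of_tendsto_of_tendsto_of_le_of_le' tendsto_const_nhds hp
      (Eventually.of_forall fun t => failFraction_nonneg _ _ _) ?_
    filter_upwards [hgood] with t ⟨hm, hNt, hr⟩
    have hfl : ⌊p * N t⌋₊ ≤ N t := floor_mul_le hp1 _
    -- Below `⌊p * N t⌋₊` subsets of certified sets are robust; above it, a certified subset
    -- suffices; beyond `N t` there are no sets.
    rcases le_or_gt (k t) (N t) with hkN | hkN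
    · rcases le_total (k t) ⌊p * N t⌋₊ with h | h
      · exact failFraction_le_of_supersets_fail h hfl fun A B _ _ hAB hB =>
          ((hB.robust (hreg t)).mono hAB).corrects hm _ _ _
      · refine failFraction_le_of_subsets_fail h hkN fun A B hA hB hAB hQ => ?_
        exact corrects_of_robust_density hm hη hη0 hp₁s' hr hNt hw1 hpv hAB
          (hQ.robust (hreg t)) hA (hB ▸ hk t)
    · rw [failFraction_eq_zero_of_lt hkN]
      exact failFraction_nonneg _ _ _
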